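/- Let $f:(-1,+\infty)\to\mathbb R$ be of class $C^2$ with $\lim_{y\to-1^+}f(y)=+\infty$, $f(0)=0$, $f'(0)=-1$ and $f'(y)<0<f''(y)$ for all $y>-1$. Let $\omega>0$ and $T=2\pi/\omega$. Then for every $A\ge 0$ the equation $$y'=f(y)+A\sin\omega t$$ has a unique $T$-periodic solution $t\mapsto Y(t,A)$ on $\mathbb R$ with values in $(-1,+\infty)$. For every $t$, the function $A\mapsto Y(t,A)$ is twice differentiable on $[0,+\infty)$ (with one-sided derivatives at $A=0$). The derivatives $Z=\partial Y/\partial A$ and $W=\partial^2Y/\partial A^2$ are, for each $A\ge 0$, the unique $T$-periodic solutions on $\mathbb R$ of $$Z'=f'(Y)\,Z+\sin\omega t,\qquad W'=f''(Y)\,Z^2+f'(Y)\,W$$ respectively. Moreover $W(t,A)>0$ for all $t\in\mathbb R$ and all $A\ge 0$, and for every $t$ the function $A\mapsto Y(t,A)$ is strictly convex on $[0,+\infty)$. -/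

import Mathlib

open Set Filter Topology

/-- The standing assumptions on the nonlinearity `f` on the open half-line `]-1, +∞[`: it is of
class `C²`, blows up to `+∞` at `-1`, satisfies `f 0 = 0` and `f' 0 = -1`, and is strictly
decreasing and strictly convex in the sense `f' < 0 < f''`. Values of `f` outside `]-1, +∞[`
play no role. -/
structure IsContactLaw (f : ℝ → ℝ) : Prop where
  contDiffOn : ContDiffOn ℝ 2 f (Ioi (-1))
  tendsto_atTop : Tendsto f (𝓝[>] (-1)) atTop
  map_zero : f 0 = 0
  deriv_zero : deriv f 0 = -1
  deriv_neg : ∀ y, -1 < y → deriv f y < 0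
  deriv2_pos : ∀ y, -1 < y → 0 < deriv (deriv f) y

/-- `y` is the unique `T`-periodic function on the real line that solves `y' = G(t, y)`
with values in `D`. -/
def IsUniquePeriodicSolution (T : ℝ) (D : Set ℝ) (G : ℝ → ℝ → ℝ) (y : ℝ → ℝ) : Prop :=
  (Function.Periodic y T ∧ ∀ t, y t ∈ D ∧ HasDerivAt y (G t (y t)) t) ∧
    ∀ x : ℝ → ℝ, Function.Periodic x T →
      (∀ t, x t ∈ D ∧ HasDerivAt x (G t (x t)) t) → x = y

/-! Everything rests on one remark: a differentiable periodic function has zero derivative at its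
extrema. Hence a periodic `q` with `q' = a q + ρ`, `a ≤ -ε < 0`, satisfies `|q| ≤ sup |ρ| / ε`
(`Function.Periodic.abs_le_div_of_dissipative`). The same remark gives uniqueness and confines
periodic responses to a compact `[m, M]` inside `]-1, +∞[`, so `f` may be replaced outside it by a
function with slopes in a compact part of `]-∞, 0[`; for that equation a contraction produces the
periodic solution. The remainders of the expansions of `Y` and `Z` in `A` solve linear equations
with coefficient `f'(Y) ≤ f'(M) < 0` and Taylor residuals, so they are `o(a - A)` uniformly in time.
Finally `W` is forced by `f''(Y) Z² ≥ 0`, not identically zero, which gives `W > 0` and strict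
convexity. -/

open Asymptotics

/-! ### Maximum principle for periodic functions. -/

/-- A differentiable periodic function attains its maximum, at a zero of its derivative. -/
theorem Function.Periodic.exists_max_deriv_eq_zero {T : ℝ} (hT : 0 < T) {u u' : ℝ → ℝ}
    (hp : Function.Periodic u T) (hd : ∀ t, HasDerivAt u (u' t) t) :
    ∃ t₀, u' t₀ = 0 ∧ ∀ t, u t ≤ u t₀ := by
  have hc : Continuous u := continuous_iff_continuousAt.2 fun t => (hd t).continuousAt
  obtain ⟨t₀, -, h₀⟩ := (isCompact_Icc (a := (0 : ℝ)) (b := T)).exists_isMaxOn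
    (nonempty_Icc.2 hT.le) hc.continuousOn
  have hmax : ∀ t, u t ≤ u t₀ := fun t => by
    obtain ⟨s, hs, hst⟩ := hp.exists_mem_Ico₀ hT t
    exact hst ▸ h₀ (Ico_subset_Icc_self hs)
  exact ⟨t₀, IsLocalMax.hasDerivAt_eq_zero (Eventually.of_forall hmax) (hd t₀), hmax⟩

/-- A differentiable periodic function attains its minimum, at a zero of its derivative. -/
theorem Function.Periodic.exists_min_deriv_eq_zero {T : ℝ} (hT : 0 < T) {u u' : ℝ → ℝ}
    (hp : Function.Periodic u T) (hd : ∀ t, HasDerivAt u (u' t) t) :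
    ∃ t₀, u' t₀ = 0 ∧ ∀ t, u t₀ ≤ u t := by
  obtain ⟨t₀, h₀, h⟩ := Function.Periodic.exists_max_deriv_eq_zero hT (u := fun t => -u t)
    (fun t => by simp only [hp t]) (fun t => (hd t).neg)
  exact ⟨t₀, by simpa using h₀, fun t => by simpa using h t⟩

/-- A priori bound for periodic functions satisfying a dissipative differential inequality. -/
theorem Function.Periodic.abs_le_div_of_dissipative {T : ℝ} (hT : 0 < T) {r r' : ℝ → ℝ}
    (hp : Function.Periodic r T) (hd : ∀ t, HasDerivAt r (r' t) t) {ε B : ℝ} (hε : 0 < ε)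
    (hB : 0 ≤ B) (h : ∀ t, r t * r' t ≤ B * |r t| - ε * r t ^ 2) (t : ℝ) : |r t| ≤ B / ε := by
  -- Unlike `|r|`, the square is differentiable; where it is maximal `r r' = 0`, so `ε r² ≤ B |r|`.
  obtain ⟨t₀, h₀, hmax⟩ := Function.Periodic.exists_max_deriv_eq_zero hT
    (u := fun t => r t ^ 2) (fun t => by simp only [hp t]) (fun t => (hd t).pow 2)
  have h₁ : r t₀ * r' t₀ = 0 := by
    simp only [Nat.cast_ofNat, Nat.add_one_sub_one, pow_one] at h₀
    linarith
  refine (sq_le_sq.1 (hmax t)).trans ?_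
  rw [le_div_iff₀ hε]
  have h₂ := h t₀
  rw [h₁, ← sq_abs] at h₂
  rcases (abs_nonneg (r t₀)).eq_or_lt with h₃ | h₃
  · rw [← h₃]; simpa using hB
  · by_contra! hlt
    nlinarith

/-- Periodic solutions of a scalar equation whose right-hand side is strictly decreasing in the
unknown are unique. -/
theorem periodic_solution_unique {T : ℝ} (hT : 0 < T) {D : Set ℝ} {G : ℝ → ℝ → ℝ}
    (hG : ∀ t, StrictAntiOn (G t) D) {x y : ℝ → ℝ} (hxp : Function.Periodic x T)
    (hx : ∀ t, x t ∈ D ∧ HasDerivAt x (G t (x t)) t) (hyp : Function.Periodic y T)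
    (hy : ∀ t, y t ∈ D ∧ HasDerivAt y (G t (y t)) t) : x = y := by
  have key : ∀ {x y : ℝ → ℝ}, Function.Periodic x T →
      (∀ t, x t ∈ D ∧ HasDerivAt x (G t (x t)) t) → Function.Periodic y T →
      (∀ t, y t ∈ D ∧ HasDerivAt y (G t (y t)) t) → ∀ t, x t ≤ y t := by
    intro x y hxp hx hyp hy t
    obtain ⟨t₀, h₀, hmax⟩ := Function.Periodic.exists_max_deriv_eq_zero hT
      (u := fun t => x t - y t) (fun t => by simp only [hxp t, hyp t])
      (fun t => (hx t).2.sub (hy t).2)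
    have : x t₀ = y t₀ := (hG t₀).injOn (hx t₀).1 (hy t₀).1 (sub_eq_zero.1 h₀)
    have := hmax t
    linarith
  exact funext fun t => le_antisymm (key hxp hx hyp hy t) (key hyp hy hxp hx t)

/-! ### Existence for uniformly dissipative equations. -/

/-- The equation `u' = h - L u` with continuous periodic `h` has a periodic solution. -/
theorem exists_periodic_solution_linear {T L : ℝ} (hT : 0 < T) (hL : 0 < L) {h : ℝ → ℝ}
    (hc : Continuous h) (hp : Function.Periodic h T) :
    ∃ u : ℝ → ℝ, Function.Periodic u T ∧ ∀ t, HasDerivAt u (h t - L * u t) t := by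
  set I : ℝ → ℝ := fun t => ∫ s in (0 : ℝ)..t, Real.exp (L * s) * h s with hI
  have hI' : ∀ t, HasDerivAt I (Real.exp (L * t) * h t) t := fun t =>
    intervalIntegral.integral_hasDerivAt_right
      (Continuous.intervalIntegrable (by fun_prop) _ _)
      (Continuous.stronglyMeasurableAtFilter (by fun_prop) _ _)
      (Continuous.continuousAt (by fun_prop))
  -- The initial value for which `u T = u 0`.
  set c : ℝ := I T / (Real.exp (L * T) - 1) with hcdef
  have hE : 0 < Real.exp (L * T) - 1 := by
    have := Real.add_one_lt_exp (mul_pos hL hT).ne'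
    nlinarith [mul_pos hL hT]
  set u : ℝ → ℝ := fun t => Real.exp (-(L * t)) * (c + I t) with hu
  have hud : ∀ t, HasDerivAt u (h t - L * u t) t := fun t => by
    have h₁ : HasDerivAt (fun t => Real.exp (-(L * t))) (Real.exp (-(L * t)) * (-(L * 1))) t :=
      (((hasDerivAt_id t).const_mul L).neg).exp
    have h₂ := h₁.mul ((hI' t).const_add c)
    refine h₂.congr_deriv ?_
    have : Real.exp (-(L * t)) * Real.exp (L * t) = 1 := by
      rw [← Real.exp_add]; simp
    simp only [hu]
    linear_combination (h t) * this
  refine ⟨u, fun t => ?_, hud⟩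
  have hv : ∀ s, HasDerivAt (fun s => Real.exp (L * s) * (u (s + T) - u s)) 0 s := fun s => by
    have h₁ : HasDerivAt (fun t => Real.exp (L * t)) (Real.exp (L * s) * (L * 1)) s :=
      ((hasDerivAt_id s).const_mul L).exp
    have h₂ := h₁.mul (((hud (s + T)).comp_add_const s T).sub (hud s))
    refine h₂.congr_deriv ?_
    rw [hp s]
    simp only [Pi.sub_apply]
    ring
  have hconst := is_const_of_deriv_eq_zero (fun s => (hv s).differentiableAt)
    (fun s => (hv s).deriv) t 0
  have h0 : u T = u 0 := by
    have hI0 : I 0 = 0 := by simp [hI]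
    simp only [hu, hI0, mul_zero, neg_zero, Real.exp_zero, add_zero, one_mul]
    have hcI : I T = c * (Real.exp (L * T) - 1) := by
      rw [hcdef, div_mul_cancel₀ _ hE.ne']
    have : Real.exp (-(L * T)) * Real.exp (L * T) = 1 := by
      rw [← Real.exp_add]; simp
    rw [hcI]
    linear_combination c * this
  simp only [zero_add, h0, sub_self, mul_zero, mul_eq_zero, Real.exp_ne_zero, false_or] at hconst
  linarith

/-- Existence of a periodic solution of a scalar, uniformly dissipative periodic equation. -/
theorem exists_periodic_solution_of_dissipative {T : ℝ} (hT : 0 < T) {G : ℝ → ℝ → ℝ}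
    (hG : Continuous (Function.uncurry G)) (hGp : ∀ t y, G (t + T) y = G t y) {ε L : ℝ}
    (hε : 0 < ε) (hεL : ε ≤ L)
    (hlip : ∀ t x y, |(G t x + L * x) - (G t y + L * y)| ≤ (L - ε) * |x - y|) :
    ∃ y : ℝ → ℝ, Function.Periodic y T ∧ ∀ t, HasDerivAt y (G t (y t)) t := by
  have hL : 0 < L := hε.trans_le hεL
  set S : Set (BoundedContinuousFunction ℝ ℝ) := {u | Function.Periodic u T} with hS
  have hSc : IsClosed S := by
    have : S = ⋂ t : ℝ, {u | u (t + T) = u t} := by ext u; simp [hS, Function.Periodic]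
    rw [this]
    exact isClosed_iInter fun t => isClosed_eq (by fun_prop) (by fun_prop)
  -- A fixed point of `u ↦ v` solves `y' = G(t, y)`. The source `G + L·` is `(L - ε)`-Lipschitz and
  -- solving `v' + L v = h` costs a factor `1 / L`, whence the ratio `(L - ε) / L`.
  have hex : ∀ u : S, ∃ v : S, ∀ t,
      HasDerivAt v.1 (G t (u.1 t) + L * u.1 t - L * v.1 t) t := by
    intro ⟨u, hu⟩
    obtain ⟨v, hvp, hv⟩ := exists_periodic_solution_linear hT hL
      (h := fun t => G t (u t) + L * u t)
      ((hG.comp (continuous_id.prodMk u.continuous)).add (continuous_const.mul u.continuous))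
      (fun t => by simp only [hGp, hu t])
    have hvc : Continuous v := continuous_iff_continuousAt.2 fun t => (hv t).continuousAt
    obtain ⟨t₁, -, h₁⟩ := hvp.exists_max_deriv_eq_zero hT hv
    obtain ⟨t₂, -, h₂⟩ := hvp.exists_min_deriv_eq_zero hT hv
    refine ⟨⟨BoundedContinuousFunction.mkOfBound ⟨v, hvc⟩ (v t₁ - v t₂) fun x y => ?_, hvp⟩, hv⟩
    rw [Real.dist_eq, abs_le]
    constructor <;> simp only [ContinuousMap.coe_mk] <;>
      linarith [h₁ x, h₁ y, h₂ x, h₂ y]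
  choose Φ hΦ using hex
  have : CompleteSpace S := hSc.completeSpace_coe
  have : Nonempty S := ⟨⟨0, fun t => by simp⟩⟩
  have hK : 0 ≤ (L - ε) / L := div_nonneg (by linarith) hL.le
  have hcontr : ContractingWith ((L - ε) / L).toNNReal Φ := by
    refine ⟨?_, LipschitzWith.of_dist_le_mul fun u v => ?_⟩
    · rw [Real.toNNReal_lt_one, div_lt_one hL]; linarith
    rw [Real.coe_toNNReal _ hK, Subtype.dist_eq, Subtype.dist_eq,
      BoundedContinuousFunction.dist_le (mul_nonneg hK dist_nonneg)]
    intro t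
    rw [Real.dist_eq, div_mul_eq_mul_div]
    refine Function.Periodic.abs_le_div_of_dissipative hT
      (r := fun t => (Φ u).1 t - (Φ v).1 t)
      (fun t => by simp only [(Φ u).2 t, (Φ v).2 t]) (fun t => (hΦ u t).sub (hΦ v t)) hL
      (mul_nonneg (by linarith) dist_nonneg) (fun t => ?_) t
    have h₁ := hlip t (u.1 t) (v.1 t)
    have h₂ : |u.1 t - v.1 t| ≤ dist u.1 v.1 := by
      rw [← Real.dist_eq]; exact BoundedContinuousFunction.dist_coe_le_dist t
    have h₃ := h₁.trans (mul_le_mul_of_nonneg_left h₂ (by linarith))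
    have h₄ := (le_abs_self _).trans ((abs_mul ((Φ u).1 t - (Φ v).1 t)
      ((G t (u.1 t) + L * u.1 t) - (G t (v.1 t) + L * v.1 t))).le.trans
        (mul_le_mul_of_nonneg_left h₃ (abs_nonneg _)))
    nlinarith
  refine ⟨(hcontr.fixedPoint Φ).1, (hcontr.fixedPoint Φ).2, fun t => ?_⟩
  have := hΦ (hcontr.fixedPoint Φ) t
  rw [hcontr.fixedPoint_isFixedPt] at this
  simpa using this

/-- Existence of a periodic solution of a linear equation `z' = a z + b` with negative `a`. -/
theorem exists_periodic_solution_affine {T : ℝ} (hT : 0 < T) {a b : ℝ → ℝ}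
    (ha : Continuous a) (hb : Continuous b) (hap : Function.Periodic a T)
    (hbp : Function.Periodic b T) {ε L : ℝ} (hε : 0 < ε) (ha₁ : ∀ t, -L ≤ a t)
    (ha₂ : ∀ t, a t ≤ -ε) :
    ∃ z : ℝ → ℝ, Function.Periodic z T ∧ ∀ t, HasDerivAt z (a t * z t + b t) t := by
  refine exists_periodic_solution_of_dissipative hT (G := fun t z => a t * z + b t)
    (by fun_prop) (fun t y => by simp only [hap t, hbp t]) hε
    (by linarith [ha₁ 0, ha₂ 0]) (L := L) fun t x y => ?_
  have : a t * x + b t + L * x - (a t * y + b t + L * y) = (a t + L) * (x - y) := by ring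
  rw [this, abs_mul, abs_of_nonneg (by linarith [ha₁ t])]
  exact mul_le_mul_of_nonneg_right (by linarith [ha₂ t]) (abs_nonneg _)

/-! ### Contact laws: monotonicity, dissipativity, extension. -/

namespace IsContactLaw

variable {f : ℝ → ℝ}

theorem hasDerivAt (hf : IsContactLaw f) {y : ℝ} (hy : -1 < y) : HasDerivAt f (deriv f y) y :=
  ((hf.contDiffOn.differentiableOn (by norm_num)).differentiableAt (Ioi_mem_nhds hy)).hasDerivAt

theorem contDiffOn_deriv (hf : IsContactLaw f) : ContDiffOn ℝ 1 (deriv f) (Ioi (-1)) :=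
  hf.contDiffOn.deriv_of_isOpen isOpen_Ioi (by norm_num)

theorem hasDerivAt_deriv (hf : IsContactLaw f) {y : ℝ} (hy : -1 < y) :
    HasDerivAt (deriv f) (deriv (deriv f) y) y :=
  ((hf.contDiffOn_deriv.differentiableOn (by norm_num)).differentiableAt
    (Ioi_mem_nhds hy)).hasDerivAt

theorem continuousOn_deriv (hf : IsContactLaw f) : ContinuousOn (deriv f) (Ioi (-1)) :=
  hf.contDiffOn_deriv.continuousOn

theorem continuousOn_deriv_deriv (hf : IsContactLaw f) :
    ContinuousOn (deriv (deriv f)) (Ioi (-1)) :=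
  hf.contDiffOn_deriv.continuousOn_deriv_of_isOpen isOpen_Ioi (by norm_num)

theorem strictAntiOn (hf : IsContactLaw f) : StrictAntiOn f (Ioi (-1)) :=
  strictAntiOn_of_deriv_neg (convex_Ioi _) hf.contDiffOn.continuousOn fun y hy =>
    hf.deriv_neg y (by simpa using hy)

theorem strictMonoOn_deriv (hf : IsContactLaw f) : StrictMonoOn (deriv f) (Ioi (-1)) :=
  strictMonoOn_of_deriv_pos (convex_Ioi _) hf.continuousOn_deriv fun y hy =>
    hf.deriv2_pos y (by simpa using hy)

theorem exists_le_apply (hf : IsContactLaw f) (A : ℝ) : ∃ m, -1 < m ∧ m < 0 ∧ A ≤ f m := by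
  have h₁ : ∀ᶠ m in 𝓝[>] (-1 : ℝ), m < 0 :=
    mem_nhdsWithin_of_mem_nhds (Iio_mem_nhds (by norm_num))
  obtain ⟨m, hm, hm0, hmA⟩ := ((eventually_mem_nhdsWithin (s := Ioi (-1 : ℝ))).and
    (h₁.and (hf.tendsto_atTop.eventually_ge_atTop A))).exists
  exact ⟨m, hm, hm0, hmA⟩

/-- Uniform dissipativity of `f` on `]-1, M]`. -/
theorem mul_sub_le (hf : IsContactLaw f) {M x y : ℝ} (hx : x ∈ Ioc (-1) M)
    (hy : y ∈ Ioc (-1) M) : (x - y) * (f x - f y) ≤ deriv f M * (x - y) ^ 2 := by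
  have key : ∀ {x y : ℝ}, x ∈ Ioc (-1) M → y ∈ Ioc (-1) M → x ≤ y →
      f y - f x ≤ deriv f M * (y - x) := by
    intro x y hx hy hxy
    have hM : -1 < M := hx.1.trans_le hx.2
    refine (convex_Ioc (-1 : ℝ) M).image_sub_le_mul_sub_of_deriv_le
      (hf.contDiffOn.continuousOn.mono fun z hz => hz.1) ?_ ?_ x hx y hy hxy
    · exact fun z hz => (hf.hasDerivAt (interior_subset hz).1).differentiableAt.differentiableWithinAt
    · intro z hz
      have hz := interior_subset hz
      exact hf.strictMonoOn_deriv.monotoneOn hz.1 hM hz.2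
  rcases le_total x y with h | h
  · nlinarith [key hx hy h]
  · nlinarith [key hy hx h]

/-- `f` agrees on `[m, M]` with a function on the line having slopes in a compact subset of
`]-∞, 0[`. -/
theorem exists_extension (hf : IsContactLaw f) {m M : ℝ} (hm : -1 < m) (hm0 : m ≤ 0)
    (hM : 0 ≤ M) : ∃ φ : ℝ → ℝ, (∀ y ∈ Icc m M, φ y = f y) ∧ StrictAnti φ ∧ Continuous φ ∧
      ∀ x y, |(φ x + -deriv f m * x) - (φ y + -deriv f m * y)| ≤
        (-deriv f m - -deriv f M) * |x - y| := by
  -- Clamping to `[m, M]`: the primitive `φ` of `f' ∘ c` has slopes between `f'(m)` and `f'(M)`, and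
  -- `φ = f` on `[m, M]` since `f 0 = 0`.
  set c : ℝ → ℝ := fun s => max m (min s M) with hc
  have hmc : ∀ s, m ≤ c s := fun s => le_max_left _ _
  have hcM : ∀ s, c s ≤ M := fun s => max_le (hm0.trans hM) (min_le_right _ _)
  have hc1 : ∀ s, c s ∈ Ioi (-1 : ℝ) := fun s => hm.trans_le (hmc s)
  have hM1 : M ∈ Ioi (-1 : ℝ) := lt_of_lt_of_le (by norm_num) hM
  have hg : Continuous fun s => deriv f (c s) :=
    hf.continuousOn_deriv.comp_continuous (by fun_prop) hc1
  set φ : ℝ → ℝ := fun y => ∫ s in (0 : ℝ)..y, deriv f (c s) with hφ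
  have hφd : ∀ y, HasDerivAt φ (deriv f (c y)) y := fun y =>
    intervalIntegral.integral_hasDerivAt_right (hg.intervalIntegrable _ _)
      (hg.stronglyMeasurableAtFilter _ _) hg.continuousAt
  refine ⟨φ, fun y hy => ?_, ?_, ?_, ?_⟩
  · have h0 : (0 : ℝ) ∈ Icc m M := ⟨hm0, hM⟩
    have : ∀ s ∈ uIcc 0 y, HasDerivAt f (deriv f (c s)) s := fun s hs => by
      have hs' := uIcc_subset_Icc h0 hy hs
      have : c s = s := by simp [hc, hs'.1, hs'.2]
      rw [this]
      exact hf.hasDerivAt (hm.trans_le hs'.1)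
    rw [hφ]
    simp only
    rw [intervalIntegral.integral_eq_sub_of_hasDerivAt this (hg.intervalIntegrable _ _),
      hf.map_zero, sub_zero]
  · exact strictAnti_of_deriv_neg fun y => by rw [(hφd y).deriv]; exact hf.deriv_neg _ (hc1 y)
  · exact continuous_iff_continuousAt.2 fun y => (hφd y).continuousAt
  · intro x y
    refine convex_univ.norm_image_sub_le_of_norm_hasDerivWithin_le
      (f := fun x => φ x + -deriv f m * x)
      (fun s _ => ((hφd s).add ((hasDerivAt_id s).const_mul (-deriv f m))).hasDerivWithinAt)
      (fun s _ => ?_) (mem_univ y) (mem_univ x)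
    have h₁ := hf.strictMonoOn_deriv.monotoneOn hm (hc1 s) (hmc s)
    have h₂ := hf.strictMonoOn_deriv.monotoneOn (hc1 s) hM1 (hcM s)
    rw [Real.norm_eq_abs, abs_of_nonneg] <;> linarith

end IsContactLaw

/-! ### Bounds, existence and uniqueness of periodic responses. -/

theorem Real.sin_mul_periodic {ω : ℝ} (hω : 0 < ω) :
    Function.Periodic (fun t => Real.sin (ω * t)) (2 * Real.pi / ω) := fun t => by
  simp only
  rw [mul_add, mul_div_cancel₀ _ hω.ne', Real.sin_add_two_pi]

/-- A priori bounds for periodic solutions of `y' = φ y + A sin ωt`, `φ` strictly decreasing. -/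
theorem periodic_solution_mem_Icc {ω A m : ℝ} (hω : 0 < ω) (hA : 0 ≤ A) {φ : ℝ → ℝ} {D : Set ℝ}
    (hφ : StrictAntiOn φ D) (h0D : 0 ∈ D) (hφ0 : φ 0 = 0) (hmD : m ∈ D) (hm : A ≤ φ m)
    {y : ℝ → ℝ} (hp : Function.Periodic y (2 * Real.pi / ω))
    (hy : ∀ t, y t ∈ D ∧ HasDerivAt y (φ (y t) + A * Real.sin (ω * t)) t) (t : ℝ) :
    y t ∈ Icc m (2 * A / ω) := by
  have hT : 0 < 2 * Real.pi / ω := by positivity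
  constructor
  · obtain ⟨t₀, h₀, hmin⟩ := hp.exists_min_deriv_eq_zero hT fun t => (hy t).2
    refine le_trans ?_ (hmin t)
    -- Below `m` one has `φ > A`, so the derivative could not vanish at the minimum.
    by_contra! hlt
    have h₁ := hφ (hy t₀).1 hmD hlt
    have h₂ := mul_le_mul_of_nonneg_left (Real.neg_one_le_sin (ω * t₀)) hA
    linarith
  -- A primitive of the forcing is subtracted from `y`. Where the difference is maximal, `φ (y t₀) =
  -- 0`, so `y t₀ = 0` and the maximum is nonpositive.
  · have hcd : ∀ t, HasDerivAt (fun t => A / ω * (1 - Real.cos (ω * t)))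
        (A * Real.sin (ω * t)) t := fun t => by
      have h₁ := (((hasDerivAt_id t).const_mul ω).cos.const_sub 1).const_mul (A / ω)
      refine h₁.congr_deriv ?_
      simp only [id]
      field_simp
    obtain ⟨t₀, h₀, hmax⟩ := Function.Periodic.exists_max_deriv_eq_zero hT
      (u := fun t => y t - A / ω * (1 - Real.cos (ω * t)))
      (fun t => by
        simp only [hp t]
        rw [mul_add, mul_div_cancel₀ _ hω.ne', Real.cos_add_two_pi])
      (fun t => (hy t).2.sub (hcd t))
    have h₁ : y t₀ = 0 := hφ.injOn (hy t₀).1 h0D (by rw [hφ0]; linarith)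
    have h₂ := hmax t
    simp only [h₁] at h₂
    have hAω : 0 ≤ A / ω := by positivity
    have h₃ := mul_nonneg hAω (sub_nonneg.2 (Real.cos_le_one (ω * t₀)))
    have h₄ := mul_le_mul_of_nonneg_left (Real.neg_one_le_cos (ω * t)) hAω
    rw [mul_div_assoc]
    linarith

/-- Existence and uniqueness of the periodic response of a contact law. -/
theorem IsContactLaw.exists_isUniquePeriodicSolution {f : ℝ → ℝ} (hf : IsContactLaw f) {ω A : ℝ}
    (hω : 0 < ω) (hA : 0 ≤ A) : ∃ y : ℝ → ℝ,
      IsUniquePeriodicSolution (2 * Real.pi / ω) (Ioi (-1))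
        (fun t y => f y + A * Real.sin (ω * t)) y := by
  have hT : 0 < 2 * Real.pi / ω := by positivity
  obtain ⟨m, hm, hm0, hmA⟩ := hf.exists_le_apply A
  have hM : 0 ≤ 2 * A / ω := by positivity
  obtain ⟨φ, hφf, hφa, hφc, hφl⟩ := hf.exists_extension hm hm0.le hM
  have hM1 : -1 < 2 * A / ω := lt_of_lt_of_le (by norm_num) hM
  obtain ⟨y, hyp, hy⟩ := exists_periodic_solution_of_dissipative hT
    (G := fun t y => φ y + A * Real.sin (ω * t)) (by unfold Function.uncurry; fun_prop)
    (fun t y => by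
      have := Real.sin_mul_periodic hω t
      simp only at this ⊢
      rw [this])
    (neg_pos.2 (hf.deriv_neg _ hM1))
    (neg_le_neg (hf.strictMonoOn_deriv.monotoneOn hm hM1 (hm0.le.trans hM)))
    (fun t x y => by
      refine le_trans (le_of_eq ?_) (hφl x y)
      congr 1
      ring)
  have hb := periodic_solution_mem_Icc hω hA (hφa.strictAntiOn univ) (mem_univ 0)
    (by rw [hφf 0 ⟨hm0.le, hM⟩, hf.map_zero]) (mem_univ m)
    (by rw [hφf m ⟨le_rfl, hm0.le.trans hM⟩]; exact hmA) hyp (fun t => ⟨mem_univ _, hy t⟩)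
  have hy' : ∀ t, y t ∈ Ioi (-1) ∧ HasDerivAt y (f (y t) + A * Real.sin (ω * t)) t :=
    fun t => ⟨hm.trans_le (hb t).1, by rw [← hφf _ (hb t)]; exact hy t⟩
  exact ⟨y, ⟨hyp, hy'⟩, fun x hxp hx => periodic_solution_unique hT (D := Ioi (-1))
    (G := fun t y => f y + A * Real.sin (ω * t)) (fun t u hu v hv huv => by simpa using hf.strictAntiOn hu hv huv) hxp hx hyp hy'⟩

/-- Existence and uniqueness of the periodic solution of `z' = a z + b`, `a` negative. -/
theorem exists_isUniquePeriodicSolution_affine {T : ℝ} (hT : 0 < T) {a b : ℝ → ℝ}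
    (ha : Continuous a) (hb : Continuous b) (hap : Function.Periodic a T)
    (hbp : Function.Periodic b T) {ε L : ℝ} (hε : 0 < ε) (ha₁ : ∀ t, -L ≤ a t)
    (ha₂ : ∀ t, a t ≤ -ε) :
    ∃ z : ℝ → ℝ, IsUniquePeriodicSolution T univ (fun t z => a t * z + b t) z := by
  obtain ⟨z, hzp, hz⟩ := exists_periodic_solution_affine hT ha hb hap hbp hε ha₁ ha₂
  refine ⟨z, ⟨hzp, fun t => ⟨mem_univ _, hz t⟩⟩, fun x hxp hx =>
    periodic_solution_unique hT (D := univ) (G := fun t z => a t * z + b t) (fun t u _ v _ huv => ?_) hxp hx hzp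
      fun t => ⟨mem_univ _, hz t⟩⟩
  have := ha₂ t
  simp only
  nlinarith

/-! ### Asymptotic estimates uniform in time. -/

theorem Function.Periodic.isBigO_one_snd {T : ℝ} (hT : 0 < T) {b : ℝ → ℝ}
    (hp : Function.Periodic b T) (hb : Continuous b) (l : Filter (ℝ × ℝ)) :
    (fun p => b p.2) =O[l] (fun _ => (1 : ℝ)) := by
  obtain ⟨C, hC⟩ := (hp.compact_of_continuous hT.ne' hb).isBounded.exists_norm_le
  exact IsBigO.of_bound C (Eventually.of_forall fun p => by
    simpa using hC _ (mem_range_self p.2))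

/-- A family of periodic functions satisfying a dissipative differential inequality is controlled
by its residual, uniformly in time. -/
theorem isBigOWith_of_dissipative {T : ℝ} (hT : 0 < T) {N : Filter ℝ} {q q' ρ : ℝ × ℝ → ℝ}
    {h : ℝ → ℝ} {ε c : ℝ} (hε : 0 < ε) (hc : 0 ≤ c)
    (hq : ∀ᶠ a in N, Function.Periodic (fun t => q (a, t)) T ∧
      ∀ t, HasDerivAt (fun t => q (a, t)) (q' (a, t)) t ∧
        q (a, t) * q' (a, t) ≤ |ρ (a, t)| * |q (a, t)| - ε * q (a, t) ^ 2)
    (hρ : IsBigOWith c (N ×ˢ ⊤) ρ fun p => h p.1) :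
    IsBigOWith (c / ε) (N ×ˢ ⊤) q fun p => h p.1 := by
  -- The factor `⊤` encodes uniformity in time: eventually along `N ×ˢ ⊤` means `∀ᶠ a in N, ∀ t`.
  rw [← principal_univ] at hρ ⊢
  rw [isBigOWith_iff, eventually_prod_principal_iff] at hρ ⊢
  filter_upwards [hρ, hq] with a h₁ h₂ t _
  rw [div_mul_eq_mul_div]
  refine h₂.1.abs_le_div_of_dissipative hT (fun t => (h₂.2 t).1) hε (by positivity)
    (fun t => (h₂.2 t).2.trans ?_) t
  have := mul_le_mul_of_nonneg_right (h₁ t (mem_univ t)) (abs_nonneg (q (a, t)))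
  simp only [Real.norm_eq_abs] at this ⊢
  linarith

theorem isBigO_of_dissipative {T : ℝ} (hT : 0 < T) {N : Filter ℝ} {q q' ρ : ℝ × ℝ → ℝ}
    {h : ℝ → ℝ} {ε : ℝ} (hε : 0 < ε)
    (hq : ∀ᶠ a in N, Function.Periodic (fun t => q (a, t)) T ∧
      ∀ t, HasDerivAt (fun t => q (a, t)) (q' (a, t)) t ∧
        q (a, t) * q' (a, t) ≤ |ρ (a, t)| * |q (a, t)| - ε * q (a, t) ^ 2)
    (hρ : ρ =O[N ×ˢ ⊤] fun p => h p.1) : q =O[N ×ˢ ⊤] fun p => h p.1 := by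
  obtain ⟨c, hc, hρ⟩ := hρ.exists_nonneg
  exact (isBigOWith_of_dissipative hT hε hc hq hρ).isBigO

theorem isLittleO_of_dissipative {T : ℝ} (hT : 0 < T) {N : Filter ℝ} {q q' ρ : ℝ × ℝ → ℝ}
    {h : ℝ → ℝ} {ε : ℝ} (hε : 0 < ε)
    (hq : ∀ᶠ a in N, Function.Periodic (fun t => q (a, t)) T ∧
      ∀ t, HasDerivAt (fun t => q (a, t)) (q' (a, t)) t ∧
        q (a, t) * q' (a, t) ≤ |ρ (a, t)| * |q (a, t)| - ε * q (a, t) ^ 2)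
    (hρ : ρ =o[N ×ˢ ⊤] fun p => h p.1) : q =o[N ×ˢ ⊤] fun p => h p.1 := by
  refine IsLittleO.of_isBigOWith fun c hc => ?_
  have := isBigOWith_of_dissipative hT hε (mul_pos hc hε).le hq (hρ.def' (mul_pos hc hε))
  rwa [mul_div_cancel_right₀ _ hε.ne'] at this

/-- Converts a linear equation `q' = a q + ρ` into the inequality that the dissipative estimates
require. -/
theorem mul_add_le_of_le_neg {a ε q ρ : ℝ} (ha : a ≤ -ε) :
    q * (a * q + ρ) ≤ |ρ| * |q| - ε * q ^ 2 := by
  have h₁ : q * ρ ≤ |ρ| * |q| := by rw [← abs_mul, mul_comm]; exact le_abs_self _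
  nlinarith [sq_nonneg q]

/-- A remainder that is small uniformly in time gives pointwise derivatives. -/
theorem hasDerivWithinAt_of_isLittleO_prod_top {y : ℝ → ℝ → ℝ} {z : ℝ → ℝ} {s : Set ℝ} {A : ℝ}
    (h : (fun p : ℝ × ℝ => y p.2 p.1 - y p.2 A - (p.1 - A) * z p.2) =o[𝓝[s] A ×ˢ ⊤]
      fun p => p.1 - A) (t : ℝ) : HasDerivWithinAt (fun a => y t a) (z t) s A := by
  rw [hasDerivWithinAt_iff_isLittleO]
  exact h.comp_tendsto (tendsto_id.prodMk (tendsto_top (f := fun _ : ℝ => t)))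

/-- First order Taylor expansion with a remainder that is uniform on a compact interval. -/
theorem isLittleO_taylor_of_mem_Icc {g g' : ℝ → ℝ} {m M : ℝ}
    (hg : ∀ y ∈ Icc m M, HasDerivAt g (g' y) y) (hg' : ContinuousOn g' (Icc m M))
    {α : Type*} {l : Filter α} {u v : α → ℝ} (hu : ∀ᶠ p in l, u p ∈ Icc m M)
    (hv : ∀ᶠ p in l, v p ∈ Icc m M) (huv : Tendsto (fun p => u p - v p) l (𝓝 0)) :
    (fun p => g (u p) - g (v p) - g' (v p) * (u p - v p)) =o[l] fun p => u p - v p := by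
  refine IsLittleO.of_bound fun c hc => ?_
  obtain ⟨δ, hδ, hδc⟩ := Metric.uniformContinuousOn_iff.1
    (isCompact_Icc.uniformContinuousOn_of_continuous hg') c hc
  filter_upwards [hu, hv, huv.eventually (Metric.ball_mem_nhds 0 hδ)] with p hup hvp hd
  have hd : |u p - v p| < δ := by simpa using hd
  have hsub : uIcc (v p) (u p) ⊆ Icc m M := uIcc_subset_Icc hvp hup
  have key := (convex_uIcc (v p) (u p)).norm_image_sub_le_of_norm_hasDerivWithin_le
    (f := fun y => g y - g' (v p) * y) (f' := fun y => g' y - g' (v p) * 1) (C := c)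
    (fun y hy => ((hg y (hsub hy)).sub
      ((hasDerivAt_id y).const_mul (g' (v p)))).hasDerivWithinAt)
    (fun y hy => by
      rw [mul_one, ← dist_eq_norm]
      refine (hδc y (hsub hy) (v p) hvp ?_).le
      rw [Real.dist_eq]
      exact (abs_sub_left_of_mem_uIcc hy).trans_lt hd)
    left_mem_uIcc right_mem_uIcc
  refine le_trans (le_of_eq ?_) key
  congr 1
  ring

/-! ### Differentiability in the amplitude. -/

section Parameter

variable {f : ℝ → ℝ} {ω : ℝ} {Y : ℝ → ℝ → ℝ}

/-- The a priori bounds for amplitude `A + 1` serve all amplitudes in `[0, A + 1]`. -/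
theorem IsContactLaw.exists_eventually_mem_Icc (hf : IsContactLaw f) (hω : 0 < ω)
    (hY : ∀ A, 0 ≤ A → IsUniquePeriodicSolution (2 * Real.pi / ω) (Ioi (-1))
      (fun t y => f y + A * Real.sin (ω * t)) (fun t => Y t A)) (A : ℝ) (hA : 0 ≤ A) :
    ∃ m M, -1 < m ∧ m ≤ M ∧ (∀ t, Y t A ∈ Icc m M) ∧
      ∀ᶠ a in 𝓝[Ici 0] A, ∀ t, Y t a ∈ Icc m M := by
  obtain ⟨m, hm, hm0, hmA⟩ := hf.exists_le_apply (A + 1)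
  have key : ∀ a, 0 ≤ a → a ≤ A + 1 → ∀ t, Y t a ∈ Icc m (2 * (A + 1) / ω) := by
    intro a ha haA t
    have := periodic_solution_mem_Icc hω ha hf.strictAntiOn (by norm_num) hf.map_zero hm
      (haA.trans hmA) (hY a ha).1.1 (hY a ha).1.2 t
    exact ⟨this.1, this.2.trans (by gcongr)⟩
  refine ⟨m, 2 * (A + 1) / ω, hm, hm0.le.trans (by positivity), key A hA (by linarith), ?_⟩
  filter_upwards [self_mem_nhdsWithin,
    mem_nhdsWithin_of_mem_nhds (Iio_mem_nhds (lt_add_one A))] with a h₁ h₂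
  exact key a h₁ (le_of_lt h₂)

theorem tendsto_fst_sub_nhdsWithin_prod_top (s : Set ℝ) (A : ℝ) :
    Tendsto (fun p : ℝ × ℝ => p.1 - A) (𝓝[s] A ×ˢ ⊤) (𝓝 0) :=
  tendsto_sub_nhds_zero_iff.2 (tendsto_fst.mono_right nhdsWithin_le_nhds)

theorem IsContactLaw.isBigO_response_sub (hf : IsContactLaw f) (hω : 0 < ω)
    (hY : ∀ A, 0 ≤ A → IsUniquePeriodicSolution (2 * Real.pi / ω) (Ioi (-1))
      (fun t y => f y + A * Real.sin (ω * t)) (fun t => Y t A)) (A : ℝ) (hA : 0 ≤ A) :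
    (fun p : ℝ × ℝ => Y p.2 p.1 - Y p.2 A) =O[𝓝[Ici 0] A ×ˢ ⊤] fun p => p.1 - A := by
  obtain ⟨m, M, hm, hmM, hYA, hYa⟩ := hf.exists_eventually_mem_Icc hω hY A hA
  refine isBigO_of_dissipative (by positivity : 0 < 2 * Real.pi / ω) (h := fun a => a - A)
    (q' := fun p => f (Y p.2 p.1) + p.1 * Real.sin (ω * p.2) -
      (f (Y p.2 A) + A * Real.sin (ω * p.2))) (ρ := fun p => p.1 - A)
    (neg_pos.2 (hf.deriv_neg M (hm.trans_le hmM))) ?_ (isBigO_refl _ _)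
  filter_upwards [hYa, self_mem_nhdsWithin] with a ha ha0
  refine ⟨fun t => by simp only [(hY a ha0).1.1 t, (hY A hA).1.1 t], fun t =>
    ⟨((hY a ha0).1.2 t).2.sub ((hY A hA).1.2 t).2, ?_⟩⟩
  have h₁ := hf.mul_sub_le (x := Y t a) (y := Y t A) ⟨hm.trans_le (ha t).1, (ha t).2⟩
    ⟨hm.trans_le (hYA t).1, (hYA t).2⟩
  have h₂ : (Y t a - Y t A) * ((a - A) * Real.sin (ω * t)) ≤ |a - A| * |Y t a - Y t A| := by
    refine (le_abs_self _).trans ?_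
    rw [abs_mul, abs_mul, mul_comm]
    exact mul_le_mul_of_nonneg_right
      (mul_le_of_le_one_right (abs_nonneg _) (Real.abs_sin_le_one _)) (abs_nonneg _)
  linarith

/-- The remainder `q` solves `q' = f'(Y(t, A)) q + R`, where `R` is the Taylor remainder of `f`, of
order `o(Y(t, a) - Y(t, A))` and hence `o(a - A)`. -/
theorem IsContactLaw.isLittleO_response (hf : IsContactLaw f) (hω : 0 < ω)
    (hY : ∀ A, 0 ≤ A → IsUniquePeriodicSolution (2 * Real.pi / ω) (Ioi (-1))
      (fun t y => f y + A * Real.sin (ω * t)) (fun t => Y t A)) (A : ℝ) (hA : 0 ≤ A)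
    {z : ℝ → ℝ} (hz : IsUniquePeriodicSolution (2 * Real.pi / ω) univ
      (fun t z => deriv f (Y t A) * z + Real.sin (ω * t)) z) :
    (fun p : ℝ × ℝ => Y p.2 p.1 - Y p.2 A - (p.1 - A) * z p.2) =o[𝓝[Ici 0] A ×ˢ ⊤]
      fun p => p.1 - A := by
  obtain ⟨m, M, hm, hmM, hYA, hYa⟩ := hf.exists_eventually_mem_Icc hω hY A hA
  have hO := hf.isBigO_response_sub hω hY A hA
  have hR := (isLittleO_taylor_of_mem_Icc (l := 𝓝[Ici 0] A ×ˢ (⊤ : Filter ℝ))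
    (fun y hy => hf.hasDerivAt (hm.trans_le hy.1))
    (hf.continuousOn_deriv.mono fun y (hy : y ∈ Icc m M) => hm.trans_le hy.1)
    ((tendsto_fst.eventually hYa).mono fun p hp => hp p.2)
    (Eventually.of_forall fun p => hYA p.2)
    (hO.trans_tendsto (tendsto_fst_sub_nhdsWithin_prod_top _ A))).trans_isBigO hO
  refine isLittleO_of_dissipative (by positivity : 0 < 2 * Real.pi / ω) (h := fun a => a - A)
    (q' := fun p => f (Y p.2 p.1) + p.1 * Real.sin (ω * p.2) -
      (f (Y p.2 A) + A * Real.sin (ω * p.2)) -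
        (p.1 - A) * (deriv f (Y p.2 A) * z p.2 + Real.sin (ω * p.2)))
    (neg_pos.2 (hf.deriv_neg M (hm.trans_le hmM))) ?_ hR
  filter_upwards [self_mem_nhdsWithin] with a ha0
  refine ⟨fun t => by simp only [(hY a ha0).1.1 t, (hY A hA).1.1 t, hz.1.1 t], fun t =>
    ⟨(((hY a ha0).1.2 t).2.sub ((hY A hA).1.2 t).2).sub ((hz.1.2 t).2.const_mul _), ?_⟩⟩
  refine le_trans (le_of_eq ?_) (mul_add_le_of_le_neg (a := deriv f (Y t A)) ?_)
  · ring
  · rw [neg_neg]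
    exact hf.strictMonoOn_deriv.monotoneOn (hm.trans_le (hYA t).1) (hm.trans_le hmM) (hYA t).2

/-- The remainder `q` solves `q' = f'(Y(t, A)) q + ρ`. With `R` the Taylor remainder of `f'` and `r`
the first-order remainder of `Y`, `ρ` is the sum of `R Z(t, A)`, `f''(Y(t, A)) r Z(t, A)` and
`(f'(Y(t, a)) - f'(Y(t, A))) (Z(t, a) - Z(t, A))`. The last is a product of two `O(a - A)` factors.
-/
theorem IsContactLaw.isLittleO_sensitivity (hf : IsContactLaw f) (hω : 0 < ω)
    (hY : ∀ A, 0 ≤ A → IsUniquePeriodicSolution (2 * Real.pi / ω) (Ioi (-1))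
      (fun t y => f y + A * Real.sin (ω * t)) (fun t => Y t A)) {Z : ℝ → ℝ → ℝ}
    (hZ : ∀ A, 0 ≤ A → IsUniquePeriodicSolution (2 * Real.pi / ω) univ
        (fun t z => deriv f (Y t A) * z + Real.sin (ω * t)) (fun t => Z t A))
    (A : ℝ) (hA : 0 ≤ A) {w : ℝ → ℝ}
    (hw : IsUniquePeriodicSolution (2 * Real.pi / ω) univ
      (fun t w => deriv (deriv f) (Y t A) * Z t A ^ 2 + deriv f (Y t A) * w) w) :
    (fun p : ℝ × ℝ => Z p.2 p.1 - Z p.2 A - (p.1 - A) * w p.2) =o[𝓝[Ici 0] A ×ˢ ⊤]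
      fun p => p.1 - A := by
  have hT : 0 < 2 * Real.pi / ω := by positivity
  obtain ⟨m, M, hm, hmM, hYA, hYa⟩ := hf.exists_eventually_mem_Icc hω hY A hA
  have hε := neg_pos.2 (hf.deriv_neg M (hm.trans_le hmM))
  have hle : ∀ {y}, y ∈ Icc m M → deriv f y ≤ - -deriv f M := fun {y} hy => by
    rw [neg_neg]
    exact hf.strictMonoOn_deriv.monotoneOn (hm.trans_le hy.1) (hm.trans_le hmM) hy.2
  have ht := tendsto_fst_sub_nhdsWithin_prod_top (Ici 0) A
  have hO := hf.isBigO_response_sub hω hY A hA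
  have ho := hf.isLittleO_response hω hY A hA (hZ A hA)
  have hR := (isLittleO_taylor_of_mem_Icc (l := 𝓝[Ici 0] A ×ˢ (⊤ : Filter ℝ))
    (fun y hy => hf.hasDerivAt_deriv (hm.trans_le hy.1))
    (hf.continuousOn_deriv_deriv.mono fun y (hy : y ∈ Icc m M) => hm.trans_le hy.1)
    ((tendsto_fst.eventually hYa).mono fun p hp => hp p.2)
    (Eventually.of_forall fun p => hYA p.2)
    (hO.trans_tendsto ht)).trans_isBigO hO
  have hYc : Continuous fun t => Y t A :=
    continuous_iff_continuousAt.2 fun t => ((hY A hA).1.2 t).2.continuousAt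
  have hZ1 := (hZ A hA).1.1.isBigO_one_snd hT
    (continuous_iff_continuousAt.2 fun t => ((hZ A hA).1.2 t).2.continuousAt)
    (𝓝[Ici 0] A ×ˢ ⊤)
  have hF1 : (fun p : ℝ × ℝ => deriv (deriv f) (Y p.2 A)) =O[𝓝[Ici 0] A ×ˢ ⊤]
      fun _ => (1 : ℝ) :=
    Function.Periodic.isBigO_one_snd hT (b := fun t => deriv (deriv f) (Y t A))
      (fun t => congrArg (deriv (deriv f)) ((hY A hA).1.1 t))
      (hf.continuousOn_deriv_deriv.comp_continuous hYc fun t => ((hY A hA).1.2 t).1) _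
  have hD : (fun p : ℝ × ℝ => deriv f (Y p.2 p.1) - deriv f (Y p.2 A)) =O[𝓝[Ici 0] A ×ˢ ⊤]
      fun p => p.1 - A := by
    have h₁ := hF1.mul hO
    simp only [one_mul] at h₁
    simpa using hR.isBigO.add h₁
  -- The difference of the two `Z` has coefficient `f'(Y(t, a))` and residual `(f'(Y(t, a)) -
  -- f'(Y(t, A))) Z(t, A)`.
  have hζ : (fun p : ℝ × ℝ => Z p.2 p.1 - Z p.2 A) =O[𝓝[Ici 0] A ×ˢ ⊤] fun p => p.1 - A := by
    have h₁ := hD.mul hZ1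
    simp only [mul_one] at h₁
    refine isBigO_of_dissipative hT (h := fun a => a - A)
      (q' := fun p => deriv f (Y p.2 p.1) * Z p.2 p.1 + Real.sin (ω * p.2) -
        (deriv f (Y p.2 A) * Z p.2 A + Real.sin (ω * p.2))) hε ?_ h₁
    filter_upwards [hYa, self_mem_nhdsWithin] with a ha ha0
    refine ⟨fun t => by simp only [(hZ a ha0).1.1 t, (hZ A hA).1.1 t], fun t =>
      ⟨((hZ a ha0).1.2 t).2.sub ((hZ A hA).1.2 t).2, ?_⟩⟩
    refine le_trans (le_of_eq ?_) (mul_add_le_of_le_neg (hle (ha t)))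
    ring
  have h₁ := hR.mul_isBigO hZ1
  have h₃ := (hF1.mul_isLittleO ho).mul_isBigO hZ1
  have h₂ := hD.mul_isLittleO ((isLittleO_one_iff ℝ).2 (hζ.trans_tendsto ht))
  simp only [one_mul, mul_one] at h₁ h₂ h₃
  refine isLittleO_of_dissipative hT (h := fun a => a - A)
    (q' := fun p => deriv f (Y p.2 p.1) * Z p.2 p.1 + Real.sin (ω * p.2) -
      (deriv f (Y p.2 A) * Z p.2 A + Real.sin (ω * p.2)) -
        (p.1 - A) * (deriv (deriv f) (Y p.2 A) * Z p.2 A ^ 2 + deriv f (Y p.2 A) * w p.2))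
    hε ?_ ((h₁.add h₃).add h₂)
  filter_upwards [self_mem_nhdsWithin] with a ha0
  refine ⟨fun t => by simp only [(hZ a ha0).1.1 t, (hZ A hA).1.1 t, hw.1.1 t], fun t =>
    ⟨(((hZ a ha0).1.2 t).2.sub ((hZ A hA).1.2 t).2).sub ((hw.1.2 t).2.const_mul _), ?_⟩⟩
  refine le_trans (le_of_eq ?_) (mul_add_le_of_le_neg (hle (hYA t)))
  ring

end Parameter

/-! ### Positivity of `W` and conclusion. -/

/-- A periodic solution of `w' = b + a w` with `a` bounded below and negative, `b ≥ 0` not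
identically zero, is positive. -/
theorem periodic_solution_pos {T L : ℝ} (hT : 0 < T) {a b w : ℝ → ℝ} (ha : ∀ t, a t < 0)
    (haL : ∀ t, -L ≤ a t) (hb : ∀ t, 0 ≤ b t) (hb0 : ∃ t, b t ≠ 0)
    (hwp : Function.Periodic w T) (hw : ∀ t, HasDerivAt w (b t + a t * w t) t) (t : ℝ) :
    0 < w t := by
  obtain ⟨t₀, h₀, hmin⟩ := hwp.exists_min_deriv_eq_zero hT hw
  have hnn : 0 ≤ w t₀ := by
    by_contra! hlt
    nlinarith [hb t₀, mul_pos_of_neg_of_neg (ha t₀) hlt]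
  have hw0 : ∀ t, 0 ≤ w t := fun t => hnn.trans (hmin t)
  refine lt_of_lt_of_le (hnn.lt_of_ne' fun hz => ?_) (hmin t)
  have hE : ∀ t, HasDerivAt (fun t => Real.exp (L * t) * w t)
      (Real.exp (L * t) * (L * 1) * w t + Real.exp (L * t) * (b t + a t * w t)) t := fun t =>
    (((hasDerivAt_id t).const_mul L).exp).mul (hw t)
  -- Since `L + a ≥ 0`, a zero of the nonnegative `w` propagates to all earlier times, then by
  -- periodicity to all times, forcing `b = 0`.
  have hmono : Monotone fun t => Real.exp (L * t) * w t := by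
    refine monotone_of_deriv_nonneg (fun t => (hE t).differentiableAt) fun t => ?_
    rw [(hE t).deriv]
    have : Real.exp (L * t) * (L * 1) * w t + Real.exp (L * t) * (b t + a t * w t) =
      Real.exp (L * t) * ((L + a t) * w t + b t) := by ring
    rw [this]
    have := haL t
    exact mul_nonneg (Real.exp_pos _).le
      (add_nonneg (mul_nonneg (by linarith) (hw0 t)) (hb t))
  have hzero : w = fun _ => 0 := funext fun t => by
    obtain ⟨n, hn⟩ := exists_nat_ge ((t - t₀) / T)
    rw [div_le_iff₀ hT] at hn
    have h₁ : w (t - n * T) = w t := hwp.sub_nat_mul_eq n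
    have h₂ := hmono (by linarith : t - n * T ≤ t₀)
    simp only [hz, mul_zero, h₁] at h₂
    exact le_antisymm (nonpos_of_mul_nonpos_right h₂ (Real.exp_pos _)) (hw0 t)
  obtain ⟨s, hs⟩ := hb0
  have h₁ := hw s
  rw [hzero] at h₁
  have h₂ := h₁.unique (hasDerivAt_const s (0 : ℝ))
  simp only [mul_zero, add_zero] at h₂
  exact hs h₂

theorem proposition4p4 (f : ℝ → ℝ) (hf : IsContactLaw f) (ω : ℝ) (hω : 0 < ω) :
    ∃ Y Z W : ℝ → ℝ → ℝ,
      -- for each `A ≥ 0`, `Y(·, A)` is the `T`-periodic solution of `y' = f(y) + A sin ωt`,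
      -- where `T = 2π/ω`
      (∀ A, 0 ≤ A → IsUniquePeriodicSolution (2 * Real.pi / ω) (Ioi (-1))
        (fun t y => f y + A * Real.sin (ω * t)) (fun t => Y t A)) ∧
      -- `Z = ∂Y/∂A` and `W = ∂²Y/∂A²` on `[0, +∞[` (one-sided at `A = 0`)
      (∀ A, 0 ≤ A → ∀ t, HasDerivWithinAt (fun a => Y t a) (Z t A) (Ici 0) A) ∧
      (∀ A, 0 ≤ A → ∀ t, HasDerivWithinAt (fun a => Z t a) (W t A) (Ici 0) A) ∧
      -- `Z(·, A)` is the `T`-periodic solution of `Z' = f'(Y) Z + sin ωt`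
      (∀ A, 0 ≤ A → IsUniquePeriodicSolution (2 * Real.pi / ω) univ
        (fun t z => deriv f (Y t A) * z + Real.sin (ω * t)) (fun t => Z t A)) ∧
      -- `W(·, A)` is the `T`-periodic solution of `W' = f''(Y) Z² + f'(Y) W`
      (∀ A, 0 ≤ A → IsUniquePeriodicSolution (2 * Real.pi / ω) univ
        (fun t w => deriv (deriv f) (Y t A) * Z t A ^ 2 + deriv f (Y t A) * w)
        (fun t => W t A)) ∧
      -- `W` is strictly positive, and `Y` is pointwise strictly convex in `A`
      (∀ A, 0 ≤ A → ∀ t, 0 < W t A) ∧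
      (∀ t, StrictConvexOn ℝ (Ici 0) (fun A => Y t A)) := by
  have hT : 0 < 2 * Real.pi / ω := by positivity
  have hYex : ∀ A : ℝ, ∃ y : ℝ → ℝ, 0 ≤ A → IsUniquePeriodicSolution (2 * Real.pi / ω)
      (Ioi (-1)) (fun t y => f y + A * Real.sin (ω * t)) y := fun A => by
    by_cases hA : 0 ≤ A
    · exact (hf.exists_isUniquePeriodicSolution hω hA).imp fun _ h _ => h
    -- Filler for `A < 0`, where nothing is claimed.
    · exact ⟨0, fun h => absurd h hA⟩
  choose Y hY using hYex
  have hYm := hf.exists_eventually_mem_Icc hω (Y := fun t A => Y A t) hY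
  have hYc : ∀ A, 0 ≤ A → Continuous (Y A) := fun A hA =>
    continuous_iff_continuousAt.2 fun t => ((hY A hA).1.2 t).2.continuousAt
  have hac : ∀ A, 0 ≤ A → Continuous fun t => deriv f (Y A t) := fun A hA =>
    hf.continuousOn_deriv.comp_continuous (hYc A hA) fun t => ((hY A hA).1.2 t).1
  have hap : ∀ A, 0 ≤ A → Function.Periodic (fun t => deriv f (Y A t)) (2 * Real.pi / ω) :=
    fun A hA t => congrArg (deriv f) ((hY A hA).1.1 t)
  have hbound : ∀ A, 0 ≤ A → ∃ ε L, 0 < ε ∧ (∀ t, -L ≤ deriv f (Y A t)) ∧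
      ∀ t, deriv f (Y A t) ≤ -ε := fun A hA => by
    obtain ⟨m, M, hm, hmM, hYA, -⟩ := hYm A hA
    refine ⟨-deriv f M, -deriv f m, neg_pos.2 (hf.deriv_neg M (hm.trans_le hmM)),
      fun t => ?_, fun t => ?_⟩ <;> rw [neg_neg]
    · exact hf.strictMonoOn_deriv.monotoneOn hm (hm.trans_le (hYA t).1) (hYA t).1
    · exact hf.strictMonoOn_deriv.monotoneOn (hm.trans_le (hYA t).1) (hm.trans_le hmM) (hYA t).2
  have hlin : ∀ A : ℝ, 0 ≤ A → ∀ b : ℝ → ℝ, Continuous b →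
      Function.Periodic b (2 * Real.pi / ω) → ∃ z : ℝ → ℝ, IsUniquePeriodicSolution
        (2 * Real.pi / ω) univ (fun t z => deriv f (Y A t) * z + b t) z := by
    intro A hA b hb hbp
    obtain ⟨ε, L, hε, h₁, h₂⟩ := hbound A hA
    exact exists_isUniquePeriodicSolution_affine hT (hac A hA) hb (hap A hA) hbp hε h₁ h₂
  have hZex : ∀ A : ℝ, ∃ z : ℝ → ℝ, 0 ≤ A → IsUniquePeriodicSolution (2 * Real.pi / ω)
      univ (fun t z => deriv f (Y A t) * z + Real.sin (ω * t)) z := fun A => by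
    by_cases hA : 0 ≤ A
    · exact (hlin A hA _ (by fun_prop) (Real.sin_mul_periodic hω)).imp fun _ h _ => h
    · exact ⟨0, fun h => absurd h hA⟩
  choose Z hZ using hZex
  have hWex : ∀ A : ℝ, ∃ w : ℝ → ℝ, 0 ≤ A → IsUniquePeriodicSolution (2 * Real.pi / ω)
      univ (fun t w => deriv (deriv f) (Y A t) * Z A t ^ 2 + deriv f (Y A t) * w) w := fun A => by
    by_cases hA : 0 ≤ A
    · have hZc : Continuous (Z A) :=
        continuous_iff_continuousAt.2 fun t => ((hZ A hA).1.2 t).2.continuousAt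
      have hFc : Continuous fun t => deriv (deriv f) (Y A t) :=
        hf.continuousOn_deriv_deriv.comp_continuous (hYc A hA) fun t => ((hY A hA).1.2 t).1
      obtain ⟨w, hw⟩ := hlin A hA (fun t => deriv (deriv f) (Y A t) * Z A t ^ 2) (by fun_prop)
        (fun t => by simp only [(hY A hA).1.1 t, (hZ A hA).1.1 t])
      simp only [add_comm (deriv f _ * _)] at hw
      exact ⟨w, fun _ => hw⟩
    · exact ⟨0, fun h => absurd h hA⟩
  choose W hW using hWex
  have hYd : ∀ A, 0 ≤ A → ∀ t, HasDerivWithinAt (fun a => Y a t) (Z A t) (Ici 0) A :=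
    fun A hA t => hasDerivWithinAt_of_isLittleO_prod_top (y := fun t a => Y a t)
      (hf.isLittleO_response hω (Y := fun t A => Y A t) hY A hA (hZ A hA)) t
  have hZd : ∀ A, 0 ≤ A → ∀ t, HasDerivWithinAt (fun a => Z a t) (W A t) (Ici 0) A :=
    fun A hA t => hasDerivWithinAt_of_isLittleO_prod_top (y := fun t a => Z a t)
      (hf.isLittleO_sensitivity hω (Y := fun t A => Y A t) hY (Z := fun t A => Z A t) hZ A hA
        (hW A hA)) t
  have hWpos : ∀ A, 0 ≤ A → ∀ t, 0 < W A t := by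
    intro A hA
    obtain ⟨ε, L, hε, h₁, h₂⟩ := hbound A hA
    refine periodic_solution_pos hT (fun t => (h₂ t).trans_lt (neg_neg_of_pos hε)) h₁
      (fun t => mul_nonneg (hf.deriv2_pos _ ((hY A hA).1.2 t).1).le (sq_nonneg (Z A t))) ?_
      (hW A hA).1.1 fun t => ((hW A hA).1.2 t).2
    by_contra! hb
    have hZ0 : Z A = fun _ => 0 := funext fun t => by
      simpa [(hf.deriv2_pos _ ((hY A hA).1.2 t).1).ne'] using hb t
    -- At this time `sin ωt = 1`, so the zero function cannot solve the equation for `Z`.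
    have h₃ := ((hZ A hA).1.2 (Real.pi / 2 / ω)).2
    rw [hZ0] at h₃
    have h₄ := h₃.unique (hasDerivAt_const _ (0 : ℝ))
    simp only at h₄
    rw [mul_div_cancel₀ _ hω.ne', Real.sin_pi_div_two] at h₄
    norm_num at h₄
  refine ⟨fun t A => Y A t, fun t A => Z A t, fun t A => W A t, hY, hYd, hZd, hZ, hW, hWpos,
    fun t => ?_⟩
  have hYi : ∀ A ∈ Ioi (0 : ℝ), HasDerivAt (fun a => Y a t) (Z A t) A := fun A hA =>
    (hYd A (le_of_lt hA) t).hasDerivAt (Ici_mem_nhds hA)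
  refine strictConvexOn_of_deriv2_pos (convex_Ici 0)
    (fun A hA => (hYd A hA t).continuousWithinAt) fun A hA => ?_
  rw [interior_Ici] at hA
  have heq : deriv (fun a => Y a t) =ᶠ[𝓝 A] fun a => Z a t := by
    filter_upwards [Ioi_mem_nhds hA] with a ha
    exact (hYi a ha).deriv
  simp only [Function.iterate_succ, Function.iterate_zero, Function.comp_apply, id]
  rw [heq.deriv_eq, ((hZd A (le_of_lt hA) t).hasDerivAt (Ici_mem_nhds hA)).deriv]
  exact hWpos A (le_of_lt hA) t
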